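/- Let $d\ge 1$ and let $(X,Y)\sim P$ take values in $[0,1]^d\times\{0,1\}$. Write $P_X$ for the law of $X$, $\Omega$ for its support, $\lambda$ for Lebesgue measure, $B(x,r)$ for Euclidean balls, $\eta(x)=\mathbb P(Y=1\mid X=x)$ and $f^*(x)=\mathbb I(\eta(x)\ge 1/2)$. Assume, for constants $c_\lambda,r_\lambda,C_\beta,C_\alpha>0$, $\beta\in(0,1]$ and $\alpha\in[0,d/\beta]$: (1) (strong density) $\lambda(\Omega\cap B(x,r))\ge c_\lambda\lambda(B(x,r))$ for all $x\in\Omega$ and $0<r<r_\lambda$, and $P_X$ has a Lebesgue density with $c_\lambda<\frac{dP_X}{d\lambda}(x)<c_\lambda^{-1}$ for all $x\in\Omega$; (2) (smoothness) $|\eta(x_1)-\eta(x_2)|\le C_\beta\|x_1-x_2\|^\beta$ for all $x_1,x_2\in\Omega$; (3) (margin) $\mathbb P(|\eta(X)-1/2|<t)\le C_\alpha t^\alpha$ for all $t\in(0,1/2]$. Let $N$ independent observations with law $P$ be divided into $m$ sub-samples of deterministic sizes $n_1\ge n_2\ge\dots\ge n_m$, $N=n_1+\dots+n_m$. For a query $x$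 and $1\le k\le n_j$ let $\hat\eta_{k,j}(x)$ be the mean of the labels of the $k$ nearest neighbors of $x$ in the $j$-th sub-sample, and let $$\hat\eta_{k_1:k_m}(x)=\frac{\sum_{j=1}^m k_j\hat\eta_{k_j,j}(x)}{\sum_{j=1}^m k_j}.$$ For $k_1=1,2,3,\dots$ put $k_j=\lceil k_1n_j/n_1\rceil$, and let $\hat k_1=\hat k_1(x)$ be the first $k_1\ge 1$ such that $$\sqrt{2\textstyle\sum_{j=1}^m k_j}\,\bigl|\hat\eta_{k_1:k_m}(x)-\tfrac12\bigr|>\sqrt{(d+2)\log N}\quad\text{or}\quad k_1\ge n_1N^{-\frac{d}{2+d}}\log N .$$ Put $\hat k_j=\lceil\hat k_1n_j/n_1\rceil$ and let $\hat f(x)=\mathbb I(\hat\eta_{\hat k_1:\hat k_m}(x)\ge 1/2)$ be the distributed adaptive nearest neighbor classifier. Its regret is $\mathcal R(\hat f)=\mathbb P(\hat f(X)\ne Y)-\mathbb P(f^*(X)\ne Y)$, where $(X,Y)\sim P$ is independent of the training data and the probability is over the training data and $(X,Y)$. Let $c>0$ and $\varepsilon<\frac{2\beta}{2\beta+d}$.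 Then there are $C>0$ and $N_0$, depending only on $d,c_\lambda,r_\lambda,\beta,C_\beta,\alpha,C_\alpha,\varepsilon,c$, such that for every such $P$, every $N\ge N_0$ and all sub-sample sizes with sum $N$ and $\min_{1\le j\le m}n_j\ge cN^{1-\varepsilon}$, $$\mathcal R(\hat f)\le C\left[\frac{N}{\log N}\right]^{-\frac{\beta(1+\alpha)}{2\beta+d}} .$$ -/

import Mathlib

open MeasureTheory

noncomputable section

namespace DistNN

/-- The ambient space of the feature vectors, with the Euclidean distance. -/
abbrev Feature (d : ℕ) : Type := EuclideanSpace ℝ (Fin d)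

/-- A feature vector together with its label in `{0, 1}`. -/
abbrev Obs (d : ℕ) : Type := Feature d × Fin 2

/-- The unit cube `[0, 1]^d`. -/
def unitCube (d : ℕ) : Set (Feature d) := {x | ∀ i, x i ∈ Set.Icc (0 : ℝ) 1}

/-! ### The distribution of an observation -/

/-- `η` is a version of the conditional probability `x ↦ ℙ(Y = 1 | X = x)`. -/
def IsRegressionFunction {d : ℕ} (P : Measure (Obs d)) [IsFiniteMeasure P]
    (η : Feature d → ℝ) : Prop :=
  ∀ᵐ x ∂P.fst, η x = (P.condKernel x).real {1}

/-- Strong density condition for the marginal law `μ` of the feature vector, whose support is `Ω`: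
`λ(Ω ∩ B(x, r)) ≥ c λ(B(x, r))` for `0 < r < r₀` and `x ∈ Ω`, and `μ` has a Lebesgue density
that lies strictly between `c` and `1 / c` on `Ω`. -/
structure StrongDensity {d : ℕ} (μ : Measure (Feature d)) (c r₀ : ℝ) : Prop where
  regular : ∀ x ∈ μ.support, ∀ r : ℝ, 0 < r → r < r₀ →
    ENNReal.ofReal c * volume (Metric.ball x r) ≤ volume (μ.support ∩ Metric.ball x r)
  density : ∃ p : Feature d → ENNReal, Measurable p ∧ μ = volume.withDensity p ∧
    ∀ x ∈ μ.support, ENNReal.ofReal c < p x ∧ p x < ENNReal.ofReal c⁻¹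

/-- `|η x₁ - η x₂| ≤ C ‖x₁ - x₂‖ ^ β` on the support of `μ`. -/
def HolderSmooth {d : ℕ} (μ : Measure (Feature d)) (η : Feature d → ℝ) (β C : ℝ) : Prop :=
  ∀ x₁ ∈ μ.support, ∀ x₂ ∈ μ.support, |η x₁ - η x₂| ≤ C * ‖x₁ - x₂‖ ^ β

/-- Margin condition `ℙ(|η(X) - 1/2| < t) ≤ C t ^ α` for all `t ∈ (0, 1/2]`. -/
def MarginCondition {d : ℕ} (μ : Measure (Feature d)) (η : Feature d → ℝ) (α C : ℝ) : Prop :=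
  ∀ t : ℝ, 0 < t → t ≤ 1 / 2 → μ.real {x | |η x - 1 / 2| < t} ≤ C * t ^ α

/-! ### Classifiers and regret -/

/-- The plug-in classifier `x ↦ 𝟙(η x ≥ 1/2)`; it is the Bayes classifier when `η` is the
regression function. -/
def plugIn {d : ℕ} (η : Feature d → ℝ) (x : Feature d) : Fin 2 :=
  if 1 / 2 ≤ η x then 1 else 0

/-- Regret of a classifier `f` trained on independent observations `z i ∼ P`, `i : ι`:
`ℙ(f(X) ≠ Y) - ℙ(f*(X) ≠ Y)`, where `(X, Y) ∼ P` is independent of the training sample, the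
probability is over the training sample and `(X, Y)`, and `f*` is the Bayes classifier. -/
def regret {d : ℕ} {ι : Type*} [Fintype ι] (P : Measure (Obs d)) [IsProbabilityMeasure P]
    (η : Feature d → ℝ) (f : (ι → Obs d) → Feature d → Fin 2) : ℝ :=
  ((Measure.pi fun _ : ι => P).prod P).real {ω | f ω.1 ω.2.1 ≠ ω.2.2}
    - P.real {z | plugIn η z.1 ≠ z.2}

/-! ### Nearest neighbor estimators -/

/-- `neighbor x z i` is the index of the `(i + 1)`-st nearest point to `x` among the feature
vectors of the sample `z` (ties in distance are broken by the order of the indices). -/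
def neighbor {d n : ℕ} (x : Feature d) (z : Fin n → Obs d) : Equiv.Perm (Fin n) :=
  Tuple.sort fun i => dist (z i).1 x

/-- The `k`-nearest neighbor estimator `(1/k) ∑_{i ≤ k} Y_(i)(x)` of `η x` (used for
`1 ≤ k ≤ n`). -/
def knnEstimate {d n : ℕ} (k : ℕ) (z : Fin n → Obs d) (x : Feature d) : ℝ :=
  (1 / (k : ℝ)) * ∑ i ∈ Finset.univ.filter (fun i : Fin n => (i : ℕ) < k), (((z (neighbor x z i)).2 : ℕ) : ℝ)

section Distributed

variable {d m : ℕ} [NeZero m] (n : Fin m → ℕ)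

/-- The whole data set, stored on `m` machines: `⟨j, i⟩` indexes the `i`-th observation on
machine `j`, which holds `n j` observations. -/
abbrev Dataset (d : ℕ) {m : ℕ} (n : Fin m → ℕ) : Type := (Σ j : Fin m, Fin (n j)) → Obs d

/-- The sub-sample on machine `j`. -/
def subsample {d m : ℕ} {n : Fin m → ℕ} (z : Dataset d n) (j : Fin m) : Fin (n j) → Obs d :=
  fun i => z ⟨j, i⟩

/-- The aggregated estimator `(∑ k_j)⁻¹ ∑ k_j η̂_{k_j, j}(x)`. -/
def distEstimate {d m : ℕ} {n : Fin m → ℕ} (k : Fin m → ℕ) (z : Dataset d n) (x : Feature d) : ℝ :=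
  (1 / ∑ j, (k j : ℝ)) * ∑ j, (k j : ℝ) * knnEstimate (k j) (subsample z j) x

/-- The number of neighbors `k_j = ⌈k₁ n_j / n₁⌉` on each machine, given the number `k₁` on the
first machine (which has index `0`). -/
def localK (k₁ : ℕ) (j : Fin m) : ℕ := ⌈(k₁ : ℝ) * n j / n 0⌉₊

/-- The total sample size. -/
def totalSize {m : ℕ} (n : Fin m → ℕ) : ℕ := ∑ j, n j

/-- The early stopping bound `n₁ N^{-d/(2+d)} log N`. -/
def earlyStop (d : ℕ) : ℝ :=
  (n 0 : ℝ) * (totalSize n : ℝ) ^ (-((d : ℝ) / (2 + d))) * Real.log (totalSize n)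

variable {n}

/-- The statistic `r_{k₁} = √(2 ∑ k_j) |η̂_{k₁:k_m}(x) - 1/2|`. -/
def signal (z : Dataset d n) (x : Feature d) (k₁ : ℕ) : ℝ :=
  √(2 * ∑ j, (localK n k₁ j : ℝ)) * |distEstimate (localK n k₁) z x - 1 / 2|

/-- The loop is left at `k₁`. -/
def Stops (z : Dataset d n) (x : Feature d) (k₁ : ℕ) : Prop :=
  √(((d : ℝ) + 2) * Real.log (totalSize n)) < signal z x k₁ ∨ earlyStop n d ≤ k₁

theorem exists_stops (z : Dataset d n) (x : Feature d) : ∃ k₁ : ℕ, 1 ≤ k₁ ∧ Stops z x k₁ := by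
  obtain ⟨k, hk⟩ := exists_nat_ge (earlyStop n d)
  refine ⟨k + 1, by omega, Or.inr ?_⟩
  push_cast
  linarith

open Classical in
/-- The data-driven `k̂₁`: the loop runs through `k₁ = 1, 2, 3, …` and is left at the first `k₁` at
which the stopping rule holds. -/
def adaptiveK (z : Dataset d n) (x : Feature d) : ℕ := Nat.find (exists_stops z x)

/-- The distributed adaptive nearest neighbor classifier. -/
def adaptiveClassifier (z : Dataset d n) (x : Feature d) : Fin 2 :=
  plugIn (distEstimate (localK n (adaptiveK z x)) z) x

end Distributed

end DistNN

end

/-! Fix a query `x` with `|η x - 1/2| ≥ t`, where `t = 2 Cβ r ^ β` and `r` is of order `(log N / N)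
^ (1 / (2β + d))`. By smoothness `η` varies by at most `t / 2` on the ball of radius `r`, so every
label drawn there has a mean on the correct side of `1/2`, with margin `t / 2`.

The aggregated estimate is the plain label mean over all `K = ∑ k_j` selected observations.
Selection uses features only, so Hoeffding's inequality bounds the deviation of the label sum by
`√(K L / 2)`, `L = (d + 2) log N`, outside probability `exp (-L)`. The signal test compares with
exactly this quantity. Hence no `k₁` whose neighbors stay in the ball can stop the loop by a signal
on the wrong side, while at `k₁ = ⌈κ n₁⌉` with `κ N t ^ 2 = 9 L` the signal is strong enough to stop
it on the right side (`adaptive_estimate_sign`). Early stopping does not intervene before that,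
because `β ≤ 1`.

Strong density gives the ball mass of order `r ^ d`, and the lower bound on `n_j` makes `n_j r ^ d`
at least of order `log N`, so by Chernoff every machine has enough points in the ball. A union bound
over `k₁` and the machines leaves an error of at most `2 / N`.

Points with margin below `t` cost at most `2 t` each, hence `2 Cα t ^ (1 + α)` in total
(`regret_le`). This is the claimed rate, and `2 / N` is absorbed because `α ≤ d / β`. -/

namespace DistNN

open ProbabilityTheory Finset

/-! ### Exponential inequalities for labels and counts -/

/-- If integrating out the `i`-th coordinate allows to drop the factor `G i`, then the product of
all factors integrates to at most one. -/
theorem lintegral_pi_prod_le_one {ι Z : Type*} [Fintype ι] [DecidableEq ι] [MeasurableSpace Z]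
    (P : Measure Z) [IsProbabilityMeasure P] (G : ι → (ι → Z) → ENNReal)
    (hG : ∀ i, Measurable (G i))
    (step : ∀ (i : ι) (S : Finset ι), i ∉ S → ∀ z : ι → Z,
      ∫⁻ w, G i (Function.update z i w) * ∏ l ∈ S, G l (Function.update z i w) ∂P ≤
        ∫⁻ w, ∏ l ∈ S, G l (Function.update z i w) ∂P) (S : Finset ι) :
    ∫⁻ z, ∏ l ∈ S, G l z ∂(Measure.pi fun _ : ι => P) ≤ 1 := by
  induction S using Finset.induction_on with
  | empty => simp
  | insert i S hi ih =>
    refine le_trans ?_ ih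
    refine lintegral_le_of_lmarginal_le {i} (Finset.measurable_prod _ fun l _ => hG l)
      (Finset.measurable_prod _ fun l _ => hG l) ?_
    intro z
    simp only [lmarginal_singleton, Finset.prod_insert hi]
    exact step i S hi z

theorem lintegral_disintegrate {d : ℕ} (P : Measure (Obs d)) [IsFiniteMeasure P]
    {f : Obs d → ENNReal} (hf : Measurable f) :
    ∫⁻ z, f z ∂P = ∫⁻ x, ∫⁻ y, f (x, y) ∂(P.condKernel x) ∂P.fst := by
  conv_lhs => rw [← P.disintegrate P.condKernel]
  exact Measure.lintegral_compProd hf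

/-- Factors that are averaged to at most one over the labels, selected by means of the feature
vectors only, have a product which integrates to at most one. -/
theorem lintegral_prod_selected_le_one {d : ℕ} {ι : Type*} [Fintype ι] [DecidableEq ι]
    (P : Measure (Obs d)) [IsProbabilityMeasure P] (h : Obs d → ENNReal) (hm : Measurable h)
    (hle : ∀ x, ∫⁻ y, h (x, y) ∂P.condKernel x ≤ 1)
    (A : ι → Set (ι → Obs d)) [∀ i, DecidablePred (· ∈ A i)] (hA : ∀ i, MeasurableSet (A i))
    (hinv : ∀ i z z', (∀ l, (z l).1 = (z' l).1) → (z ∈ A i ↔ z' ∈ A i)) :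
    ∫⁻ z, ∏ i, (if z ∈ A i then h (z i) else 1) ∂(Measure.pi fun _ : ι => P) ≤ 1 := by
  have hGm : ∀ i, Measurable fun z : ι → Obs d => if z ∈ A i then h (z i) else 1 := fun i =>
    Measurable.ite (hA i) (hm.comp (measurable_pi_apply i)) measurable_const
  refine lintegral_pi_prod_le_one P (fun i z => if z ∈ A i then h (z i) else 1) hGm ?_ _
  intro i S hi z
  have hup : Measurable fun w : Obs d => Function.update z i w := measurable_update z
  have hR : Measurable fun w : Obs d => ∏ l ∈ S,
      (if Function.update z i w ∈ A l then h (Function.update z i w l) else 1) :=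
    Finset.measurable_prod _ fun l _ => (hGm l).comp hup
  have hF := (hGm i).comp hup
  simp only [Function.comp_def] at hF
  refine (lintegral_disintegrate P (hF.mul hR)).trans_le ?_
  rw [lintegral_disintegrate P hR]
  refine lintegral_mono fun x => ?_
  simp only [Pi.mul_apply]
  have hmem : ∀ (l : ι) (y : Fin 2), (Function.update z i (x, y) ∈ A l ↔
      Function.update z i (x, 0) ∈ A l) := by
    intro l y
    refine hinv l _ _ fun k => ?_
    by_cases hk : k = i
    · subst hk; simp
    · simp [hk]
  have hprod : ∀ y : Fin 2, (∏ l ∈ S, (if Function.update z i (x, y) ∈ A l then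
      h (Function.update z i (x, y) l) else 1)) = ∏ l ∈ S,
        (if Function.update z i (x, 0) ∈ A l then h (z l) else 1) := by
    intro y
    refine Finset.prod_congr rfl fun l hl => ?_
    have hli : l ≠ i := fun e => hi (e ▸ hl)
    simp only [hmem l y, Function.update_of_ne hli]
  simp only [hprod, hmem i, Function.update_self]
  rw [lintegral_mul_const _ Measurable.of_discrete]
  simp only [lintegral_const, measure_univ, mul_one]
  refine mul_le_of_le_one_left' ?_
  split_ifs
  · exact hle x
  · simp

/-- Hoeffding's lemma for the label of an observation. -/
theorem lintegral_exp_label_le_one {d : ℕ} (P : Measure (Obs d)) [IsProbabilityMeasure P]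
    (a : ℝ) (x : Feature d) :
    ∫⁻ y, ENNReal.ofReal (Real.exp (a * (((y : ℕ) : ℝ) - (P.condKernel x).real {1}) - a ^ 2 / 8))
      ∂P.condKernel x ≤ 1 := by
  have hmean : ∫ y : Fin 2, ((y : ℕ) : ℝ) ∂P.condKernel x = (P.condKernel x).real {1} := by
    rw [integral_fintype (Integrable.of_finite)]
    simp
  have hs := hasSubgaussianMGF_of_mem_Icc (μ := P.condKernel x)
    (X := fun y : Fin 2 => ((y : ℕ) : ℝ)) (a := 0) (b := 1)
    (Measurable.of_discrete).aemeasurable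
    (Filter.Eventually.of_forall fun y => by fin_cases y <;> simp)
  have := hs.mgf_le a
  rw [hmean] at this
  simp only [mgf] at this
  rw [← ofReal_integral_eq_lintegral_ofReal Integrable.of_finite
    (Filter.Eventually.of_forall fun y => (Real.exp_pos _).le)]
  rw [← ENNReal.ofReal_one]
  refine ENNReal.ofReal_le_ofReal ?_
  simp only [Real.exp_sub]
  rw [integral_div, div_le_one (Real.exp_pos _)]
  refine this.trans (Real.exp_le_exp.2 ?_)
  norm_num
  linarith

theorem measurable_condKernel_real {d : ℕ} (P : Measure (Obs d)) [IsProbabilityMeasure P] :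
    Measurable fun x => (P.condKernel x).real {1} :=
  (Kernel.measurable_coe _ (measurableSet_singleton _)).ennreal_toReal

/-- Markov's inequality in the form shared by the Hoeffding and Chernoff arguments. -/
theorem measure_le_exp_neg {Z : Type*} [MeasurableSpace Z] {μ : Measure Z} {F : Z → ENNReal}
    (hF : Measurable F) (h1 : ∫⁻ z, F z ∂μ ≤ 1) {b : ℝ} {A : Set Z}
    (hA : ∀ z ∈ A, ENNReal.ofReal (Real.exp b) ≤ F z) :
    μ A ≤ ENNReal.ofReal (Real.exp (-b)) := by
  have h2 := (mul_meas_ge_le_lintegral (μ := μ) hF (ENNReal.ofReal (Real.exp b))).trans h1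
  have h3 : ENNReal.ofReal (Real.exp b) * μ A ≤ 1 :=
    (mul_le_mul_right (measure_mono hA) _).trans h2
  rw [Real.exp_neg, ENNReal.ofReal_inv_of_pos (Real.exp_pos _)]
  rw [← one_div, ENNReal.le_div_iff_mul_le (Or.inl (by simp [Real.exp_pos])) (Or.inl (by simp))]
  rwa [mul_comm]

/-- Hoeffding's inequality for the labels of `K` observations that are selected by means of the
feature vectors. -/
theorem measure_selected_sum_ge_le {d : ℕ} {ι : Type*} [Fintype ι] [DecidableEq ι]
    (P : Measure (Obs d)) [IsProbabilityMeasure P] (sel : (ι → Obs d) → Finset ι)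
    (hsel : ∀ i, MeasurableSet {z | i ∈ sel z})
    (hinv : ∀ z z', (∀ l, (z l).1 = (z' l).1) → sel z = sel z')
    {K : ℕ} (hK : 0 < K) (hcard : ∀ z, (sel z).card = K) {σ : ℝ} (hσ : σ ^ 2 = 1)
    {s : ℝ} (hs : 0 ≤ s) :
    (Measure.pi fun _ : ι => P) {z | s ≤ σ * ∑ i ∈ sel z,
      ((((z i).2 : ℕ) : ℝ) - (P.condKernel (z i).1).real {1})} ≤
      ENNReal.ofReal (Real.exp (-(2 * s ^ 2 / K))) := by
  classical
  have hK' : (0 : ℝ) < K := by exact_mod_cast hK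
  -- This maximises `lam * s - lam ^ 2 * K / 8`, with value `2 * s ^ 2 / K`. The sign `σ` selects
  -- the tail.
  set lam : ℝ := 4 * s / K with hlam
  set a : ℝ := lam * σ with ha
  set h : Obs d → ENNReal := fun w => ENNReal.ofReal
    (Real.exp (a * (((w.2 : ℕ) : ℝ) - (P.condKernel w.1).real {1}) - a ^ 2 / 8)) with hh
  have hm : Measurable h := by
    refine ENNReal.measurable_ofReal.comp (Real.measurable_exp.comp ?_)
    refine ((Measurable.sub ?_ ((measurable_condKernel_real P).comp measurable_fst)).const_mul
      _).sub_const _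
    exact (Measurable.of_discrete (f := fun y : Fin 2 => ((y : ℕ) : ℝ))).comp measurable_snd
  have hF : Measurable fun z : ι → Obs d => ∏ i, (if z ∈ {z | i ∈ sel z} then h (z i) else 1) :=
    Finset.measurable_prod _ fun i _ =>
      Measurable.ite (hsel i) (hm.comp (measurable_pi_apply i)) measurable_const
  have hb : -(2 * s ^ 2 / K) = -(lam * s - lam ^ 2 / 8 * K) := by
    rw [hlam]; field_simp; ring
  rw [hb]
  refine measure_le_exp_neg hF (lintegral_prod_selected_le_one P h hm
    (fun x => lintegral_exp_label_le_one P a x) (fun i => {z | i ∈ sel z}) hsel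
    fun i z z' hz => by simp [hinv z z' hz]) ?_
  intro z hz
  simp only [Set.mem_ofPred_eq] at hz ⊢
  rw [Finset.prod_ite_mem, Finset.univ_inter, hh,
    ← ENNReal.ofReal_prod_of_nonneg fun _ _ => (Real.exp_pos _).le, ← Real.exp_sum]
  refine ENNReal.ofReal_le_ofReal (Real.exp_le_exp.2 ?_)
  rw [Finset.sum_sub_distrib, ← Finset.mul_sum, Finset.sum_const, hcard, nsmul_eq_mul, ha,
    mul_pow, hσ]
  have : 0 ≤ lam := by positivity
  nlinarith [mul_le_mul_of_nonneg_left hz this]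

/-- Chernoff's bound for the lower tail of the number of observations that fall into `B`. -/
theorem measure_card_filter_le {ι Z : Type*} [Fintype ι] [DecidableEq ι] [MeasurableSpace Z]
    (P : Measure Z) [IsProbabilityMeasure P] (T : Finset ι) {B : Set Z} [DecidablePred (· ∈ B)]
    (hB : MeasurableSet B) {p : ℝ} (hpB : ENNReal.ofReal p ≤ P B) :
    (Measure.pi fun _ : ι => P) {z | (({i ∈ T | z i ∈ B}.card : ℕ) : ℝ) ≤ T.card * p / 2} ≤
      ENNReal.ofReal (Real.exp (-(T.card * p / 10))) := by
  have hpr : p ≤ P.real B := by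
    rwa [Measure.real, ← ENNReal.ofReal_le_iff_le_toReal (measure_ne_top _ _)]
  -- Since `exp (-1) ≤ 2/5`, the mean of `exp (-𝟙_B)` is at most `1 - 3p/5 ≤ exp (-3p/5)`, which the
  -- prefactor cancels. The threshold `p/2` per index then leaves the exponent `3/5 - 1/2 = 1/10`.
  set h : Z → ENNReal := fun w => ENNReal.ofReal (Real.exp (3 / 5 * p)) *
    (if w ∈ B then ENNReal.ofReal (Real.exp (-1)) else 1) with hh
  have hm : Measurable h :=
    (Measurable.ite hB measurable_const measurable_const).const_mul _
  have hint : ∫⁻ w, h w ∂P ≤ 1 := by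
    have e : ∀ w, h w = ENNReal.ofReal (Real.exp (3 / 5 * p) *
        (1 - B.indicator (fun _ => 1 - Real.exp (-1)) w)) := by
      intro w
      rw [ENNReal.ofReal_mul (Real.exp_pos _).le, hh]
      by_cases hw : w ∈ B <;> simp [hw]
    have hi : Integrable (B.indicator fun _ : Z => 1 - Real.exp (-1)) P :=
      (integrable_const _).indicator hB
    have hnn : ∀ w, 0 ≤ Real.exp (3 / 5 * p) *
        (1 - B.indicator (fun _ => 1 - Real.exp (-1)) w) := by
      intro w
      by_cases hw : w ∈ B <;> simp only [hw, Set.indicator_of_mem, Set.indicator_of_notMem,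
        not_false_eq_true, sub_sub_cancel, sub_zero] <;> positivity
    simp only [e]
    have hi' : Integrable (fun w => Real.exp (3 / 5 * p) *
        (1 - B.indicator (fun _ => 1 - Real.exp (-1)) w)) P :=
      ((integrable_const _).sub hi).const_mul _
    rw [← ofReal_integral_eq_lintegral_ofReal hi' (Filter.Eventually.of_forall hnn),
      ← ENNReal.ofReal_one]
    refine ENNReal.ofReal_le_ofReal ?_
    rw [integral_const_mul, integral_sub (integrable_const _) hi, integral_indicator_const _ hB]
    simp only [integral_const, probReal_univ, smul_eq_mul, mul_one]
    have he : Real.exp (-1) ≤ 2 / 5 := by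
      rw [Real.exp_neg, inv_le_comm₀ (Real.exp_pos _) (by norm_num)]
      have := Real.exp_one_gt_d9
      norm_num at this ⊢
      linarith
    have h1 : 1 - P.real B * (1 - Real.exp (-1)) ≤ Real.exp (-(3 / 5 * p)) := by
      have := Real.add_one_le_exp (-(3 / 5 * p))
      have h2 : p * (3 / 5) ≤ P.real B * (1 - Real.exp (-1)) :=
        mul_le_mul hpr (by linarith) (by norm_num) measureReal_nonneg
      linarith
    calc _ ≤ Real.exp (3 / 5 * p) * Real.exp (-(3 / 5 * p)) :=
          mul_le_mul_of_nonneg_left h1 (Real.exp_pos _).le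
      _ = 1 := by rw [← Real.exp_add]; simp
  have hF : ∀ i : ι, Measurable fun z : ι → Z => h (z i) := fun i =>
    hm.comp (measurable_pi_apply i)
  have hprod := lintegral_pi_prod_le_one P (fun i z => h (z i)) hF (by
    intro i S hi z
    have : ∀ w, (∏ l ∈ S, h (Function.update z i w l)) = ∏ l ∈ S, h (z l) := fun w =>
      Finset.prod_congr rfl fun l hl => by
        rw [Function.update_of_ne (ne_of_mem_of_not_mem hl hi)]
    simp only [this, Function.update_self]
    rw [lintegral_mul_const _ hm]
    simpa using mul_le_of_le_one_left' hint) T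
  refine measure_le_exp_neg (Finset.measurable_prod _ fun l _ => hF l) hprod ?_
  intro z hz
  simp only [Set.mem_ofPred_eq] at hz
  have e : ∀ i, h (z i) = ENNReal.ofReal
      (Real.exp (3 / 5 * p - if z i ∈ B then 1 else 0)) := by
    intro i
    rw [sub_eq_add_neg, Real.exp_add, ENNReal.ofReal_mul (Real.exp_pos _).le, hh]
    by_cases hw : z i ∈ B <;> simp [hw]
  simp only [e]
  rw [← ENNReal.ofReal_prod_of_nonneg fun _ _ => (Real.exp_pos _).le, ← Real.exp_sum]
  refine ENNReal.ofReal_le_ofReal (Real.exp_le_exp.2 ?_)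
  rw [Finset.sum_sub_distrib, Finset.sum_const, nsmul_eq_mul, Finset.sum_boole]
  nlinarith

/-! ### Selected neighbors across the machines -/

section Selection

variable {d m : ℕ} {n : Fin m → ℕ}

/-- The indices of the observations that enter `distEstimate k z x`. -/
noncomputable def selected (k : Fin m → ℕ) (x : Feature d) (z : Dataset d n) : Finset (Σ j : Fin m, Fin (n j)) :=
  {p | ((neighbor x (subsample z p.1)).symm p.2 : ℕ) < k p.1}

theorem sum_selected (k : Fin m → ℕ) (x : Feature d) (z : Dataset d n)
    (g : (Σ j : Fin m, Fin (n j)) → ℝ) :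
    ∑ p ∈ selected k x z, g p =
      ∑ j, ∑ i ∈ Finset.univ.filter (fun i : Fin (n j) => (i : ℕ) < k j), g ⟨j, neighbor x (subsample z j) i⟩ := by
  rw [selected, Finset.sum_filter, Fintype.sum_sigma]
  refine Finset.sum_congr rfl fun j _ => ?_
  rw [Finset.sum_filter, ← Equiv.sum_comp (neighbor x (subsample z j))]
  simp

theorem card_selected {k : Fin m → ℕ} (hk : ∀ j, k j ≤ n j) (x : Feature d) (z : Dataset d n) :
    (selected k x z).card = ∑ j, k j := by
  have h := sum_selected k x z fun _ => 1
  simp only [Finset.sum_const, nsmul_eq_mul, mul_one] at h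
  have h' : (selected k x z).card = ∑ j, #{i : Fin (n j) | (i : ℕ) < k j} := by exact_mod_cast h
  rw [h']
  refine Finset.sum_congr rfl fun j _ => ?_
  rw [Fin.card_filter_val_lt]
  exact min_eq_right (hk j)

/-- The weights `k j` cancel the local normalisations, so a single Hoeffding bound treats all
machines at once. -/
theorem sum_mul_distEstimate {k : Fin m → ℕ} (hk : ∀ j, 0 < k j) (x : Feature d)
    (z : Dataset d n) :
    (∑ j, (k j : ℝ)) * distEstimate k z x = ∑ p ∈ selected k x z, (((z p).2 : ℕ) : ℝ) := by
  rcases isEmpty_or_nonempty (Fin m) with hm | hm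
  · simp [sum_selected]
  have hpos : (0 : ℝ) < ∑ j, (k j : ℝ) :=
    Finset.sum_pos (fun j _ => by exact_mod_cast hk j) Finset.univ_nonempty
  rw [sum_selected, distEstimate, ← mul_assoc, mul_one_div_cancel hpos.ne', one_mul]
  refine Finset.sum_congr rfl fun j _ => ?_
  have : (k j : ℝ) ≠ 0 := by exact_mod_cast (hk j).ne'
  rw [knnEstimate, ← mul_assoc, mul_one_div_cancel this, one_mul]
  rfl

/-- Ranks depend on distances only; this is the invariance under relabelling that the Hoeffding
bound requires. -/
theorem selected_congr (k : Fin m → ℕ) (x : Feature d) {z z' : Dataset d n}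
    (h : ∀ p, (z p).1 = (z' p).1) : selected k x z = selected k x z' := by
  have e : ∀ j, neighbor x (subsample z j) = neighbor x (subsample z' j) := fun j => by
    simp only [neighbor, subsample, h]
  simp only [selected, e]

/-- Among the selected observations on a machine with at least `k j` observations in a ball, all
lie in that ball. -/
theorem dist_lt_of_mem_selected {k : Fin m → ℕ} {x : Feature d} {z : Dataset d n} {r : ℝ}
    {p : Σ j : Fin m, Fin (n j)} (hp : p ∈ selected k x z)
    (hcount : k p.1 ≤ #{i : Fin (n p.1) | dist (z ⟨p.1, i⟩).1 x < r}) : dist (z p).1 x < r := by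
  obtain ⟨j, i⟩ := p
  simp only [selected, Finset.mem_filter, Finset.mem_univ, true_and] at hp hcount
  by_contra! hr
  set σ := neighbor x (subsample z j) with hσ
  have hmono : Monotone ((fun i => dist (subsample z j i).1 x) ∘ σ) := Tuple.monotone_sort _
  -- Distances increase with rank, so every point of the ball ranks strictly before an observation
  -- outside it. The ball count is then at most the rank of that observation, which is below `k j`.
  have hsub : ({i : Fin (n j) | dist (z ⟨j, i⟩).1 x < r} : Finset _) ⊆
      (Finset.Iio (σ.symm i)).map σ.toEmbedding := by
    intro l hl
    simp only [Finset.mem_filter, Finset.mem_univ, true_and] at hl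
    rw [Finset.mem_map_equiv, Finset.mem_Iio]
    by_contra! hle
    have := hmono hle
    simp only [Function.comp_apply, Equiv.apply_symm_apply, subsample] at this
    linarith
  have := Finset.card_le_card hsub
  rw [Finset.card_map, Fin.card_Iio] at this
  omega

end Selection

/-! ### Joint measurability in the sample and the query -/

section Measurability

variable {d m : ℕ} {n : Fin m → ℕ}

/-- A sorting permutation with index tie-breaking is characterised by finitely many comparisons of
distances. -/
theorem measurableSet_neighbor_eq {N : ℕ} (σ : Equiv.Perm (Fin N)) :
    MeasurableSet {q : (Fin N → Obs d) × Feature d | neighbor q.2 q.1 = σ} := by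
  have hd : ∀ i : Fin N, Measurable fun q : (Fin N → Obs d) × Feature d => dist (q.1 i).1 q.2 :=
    fun i => (measurable_fst.comp ((measurable_pi_apply i).comp measurable_fst)).dist measurable_snd
  have e : {q : (Fin N → Obs d) × Feature d | neighbor q.2 q.1 = σ} =
      {q | (∀ i j, i ≤ j → dist (q.1 (σ i)).1 q.2 ≤ dist (q.1 (σ j)).1 q.2) ∧
        ∀ i j, i < j → dist (q.1 (σ i)).1 q.2 = dist (q.1 (σ j)).1 q.2 → σ i < σ j} := by
    ext q
    simp only [Set.mem_ofPred_eq]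
    rw [neighbor, eq_comm, Tuple.eq_sort_iff]
    rfl
  rw [e]
  refine MeasurableSet.inter ?_ ?_ <;> refine measurableSet_setOfPred.2 ?_
  · exact Measurable.forall fun i => Measurable.forall fun j => measurable_const.imp
      (measurableSet_setOfPred.1 (measurableSet_le (hd _) (hd _)))
  · exact Measurable.forall fun i => Measurable.forall fun j => measurable_const.imp
      ((measurableSet_setOfPred.1 (measurableSet_eq_fun (hd _) (hd _))).imp measurable_const)

theorem measurable_subsample (j : Fin m) :
    Measurable fun q : Dataset d n × Feature d => (subsample q.1 j, q.2) :=
  (measurable_pi_lambda _ fun _ => (measurable_pi_apply _).comp measurable_fst).prodMk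
    measurable_snd

theorem measurableSet_neighbor (j : Fin m) (S : Set (Equiv.Perm (Fin (n j)))) :
    MeasurableSet {q : Dataset d n × Feature d | neighbor q.2 (subsample q.1 j) ∈ S} := by
  have e : {q : Dataset d n × Feature d | neighbor q.2 (subsample q.1 j) ∈ S} =
      ⋃ σ ∈ S, {q | neighbor q.2 (subsample q.1 j) = σ} := by
    ext q; simp
  rw [e]
  exact MeasurableSet.biUnion S.to_countable fun σ _ =>
    measurable_subsample j (measurableSet_neighbor_eq σ)

theorem measurableSet_mem_selected (k : Fin m → ℕ) (p : Σ j : Fin m, Fin (n j)) :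
    MeasurableSet {q : Dataset d n × Feature d | p ∈ selected k q.2 q.1} := by
  simpa [selected] using
    measurableSet_neighbor (d := d) p.1 {σ | ((σ.symm p.2 : Fin _) : ℕ) < k p.1}

theorem measurable_distEstimate (k : Fin m → ℕ) :
    Measurable fun q : Dataset d n × Feature d => distEstimate k q.1 q.2 := by
  -- The random index of a neighbor is replaced by a sum over its possible values `l`.
  have e : ∀ q : Dataset d n × Feature d, distEstimate k q.1 q.2 =
      (1 / ∑ j, (k j : ℝ)) * ∑ j, (k j : ℝ) * (1 / (k j : ℝ) *
        ∑ i ∈ Finset.univ.filter (fun i : Fin (n j) => (i : ℕ) < k j), ∑ l : Fin (n j),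
          if neighbor q.2 (subsample q.1 j) i = l then (((q.1 ⟨j, l⟩).2 : ℕ) : ℝ) else 0) := by
    intro q
    simp [distEstimate, knnEstimate, subsample]
  simp only [e]
  have hl : ∀ (j : Fin m) (i l : Fin (n j)), Measurable fun q : Dataset d n × Feature d =>
      if neighbor q.2 (subsample q.1 j) i = l then (((q.1 ⟨j, l⟩).2 : ℕ) : ℝ) else 0 := by
    intro j i l
    have hy : Measurable fun y : Fin 2 => ((y : ℕ) : ℝ) := Measurable.of_discrete
    refine Measurable.ite (measurableSet_neighbor j {σ | σ i = l}) ?_ measurable_const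
    exact hy.comp (measurable_snd.comp ((measurable_pi_apply _).comp measurable_fst))
  exact (Finset.measurable_sum _ fun j _ => ((Finset.measurable_sum _ fun i _ =>
    Finset.measurable_sum _ fun l _ => hl j i l).const_mul _).const_mul _).const_mul _

variable [NeZero m]

theorem measurable_adaptiveK :
    Measurable fun q : Dataset d n × Feature d => adaptiveK q.1 q.2 := by
  classical
  have hs : ∀ k, MeasurableSet {q : Dataset d n × Feature d | 1 ≤ k ∧ Stops q.1 q.2 k} := by
    intro k
    have hm : Measurable fun q : Dataset d n × Feature d => signal q.1 q.2 k :=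
      (((measurable_distEstimate (localK n k)).sub_const _).abs).const_mul _
    exact (MeasurableSet.const _).inter
      ((measurableSet_lt measurable_const hm).union (MeasurableSet.const _))
  unfold adaptiveK
  convert measurable_find (fun q : Dataset d n × Feature d => exists_stops q.1 q.2) hs

theorem measurable_apply_nat {γ δ : Type*} [MeasurableSpace γ] [MeasurableSpace δ]
    {F : ℕ → γ → δ} (hF : ∀ k, Measurable (F k)) {κ : γ → ℕ} (hκ : Measurable κ) :
    Measurable fun a => F (κ a) a := by
  have h : Measurable fun q : ℕ × γ => F q.1 q.2 := measurable_from_prod_countable_right hF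
  exact h.comp (hκ.prodMk measurable_id)

theorem measurable_adaptiveClassifier :
    Measurable fun q : Dataset d n × Feature d => adaptiveClassifier q.1 q.2 := by
  have h : Measurable fun q : Dataset d n × Feature d =>
      distEstimate (localK n (adaptiveK q.1 q.2)) q.1 q.2 :=
    measurable_apply_nat (F := fun k (q : Dataset d n × Feature d) =>
      distEstimate (localK n k) q.1 q.2) (fun k => measurable_distEstimate (localK n k))
      (κ := fun q => adaptiveK q.1 q.2) measurable_adaptiveK
  have hp : Measurable fun t : ℝ => if 1 / 2 ≤ t then (1 : Fin 2) else 0 :=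
    Measurable.ite measurableSet_Ici measurable_const measurable_const
  have hc := hp.comp h
  exact hc

end Measurability

/-! ### The stopping rule on the good event -/

section Deterministic

variable {d m : ℕ} [NeZero m] {n : Fin m → ℕ}

theorem localK_mono {k k' : ℕ} (h : k ≤ k') (j : Fin m) : localK n k j ≤ localK n k' j := by
  unfold localK
  gcongr

theorem localK_pos (hn : ∀ j, 0 < n j) {k : ℕ} (hk : 1 ≤ k) (j : Fin m) : 0 < localK n k j := by
  have h0 : (0 : ℝ) < n 0 := by exact_mod_cast hn 0
  have hj : (0 : ℝ) < n j := by exact_mod_cast hn j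
  have hk' : (0 : ℝ) < k := by exact_mod_cast hk
  exact Nat.ceil_pos.2 (by positivity)

theorem localK_zero (hn : 0 < n 0) (k : ℕ) : localK n k 0 = k := by
  have h0 : (n 0 : ℝ) ≠ 0 := by exact_mod_cast hn.ne'
  rw [localK, mul_div_assoc, div_self h0, mul_one, Nat.ceil_natCast]

theorem localK_le (hn : ∀ j, 0 < n j) (k : ℕ) (hk : k ≤ n 0) (j : Fin m) : localK n k j ≤ n j := by
  have h0 : (0 : ℝ) < n 0 := by exact_mod_cast hn 0
  have hk' : (k : ℝ) ≤ n 0 := by exact_mod_cast hk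
  refine Nat.ceil_le.2 ?_
  rw [div_le_iff₀ h0, mul_comm]
  gcongr

/-- If the labels of the selected observations do not deviate from their means and each machine
holds enough observations near `x`, then the adaptive estimator is on the same side of `1/2` as the
regression function. -/
theorem adaptive_estimate_sign (hn : ∀ j, 0 < n j) (z : Dataset d n) (x : Feature d)
    {σ : ℝ} (hσ : |σ| = 1) (f : Feature d → ℝ) {t r κ : ℝ} (ht : 0 < t) (hκ : 0 < κ)
    (hx : t ≤ σ * (f x - 1 / 2))
    (hclose : ∀ p, dist (z p).1 x < r → |f (z p).1 - f x| ≤ t / 2)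
    (hcount : ∀ j, localK n ⌈κ * n 0⌉₊ j ≤ #{i : Fin (n j) | dist (z ⟨j, i⟩).1 x < r})
    (hdev : ∀ k, 1 ≤ k → k ≤ n 0 →
      σ * ∑ p ∈ selected (localK n k) x z, (f (z p).1 - (((z p).2 : ℕ) : ℝ)) <
        √((∑ j, (localK n k j : ℝ)) * (((d : ℝ) + 2) * Real.log (totalSize n)) / 2))
    (hL : 0 < Real.log (totalSize n))
    (hsig : 9 * (((d : ℝ) + 2) * Real.log (totalSize n)) ≤ κ * totalSize n * t ^ 2)
    (hκN : κ < (totalSize n : ℝ) ^ (-((d : ℝ) / (2 + d))) * Real.log (totalSize n)) :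
    0 < σ * (distEstimate (localK n (adaptiveK z x)) z x - 1 / 2) := by
  classical
  set L : ℝ := ((d : ℝ) + 2) * Real.log (totalSize n) with hLdef
  have hLpos : 0 < L := by positivity
  have h0 : (0 : ℝ) < n 0 := by exact_mod_cast hn 0
  set ks : ℕ := ⌈κ * n 0⌉₊ with hks
  have hks1 : 1 ≤ ks := Nat.ceil_pos.2 (by positivity)
  have hks0 : ks ≤ n 0 := by
    have h1 := hcount 0
    rw [localK_zero (hn 0)] at h1
    refine h1.trans ((Finset.card_le_univ _).trans ?_)
    simp
  have hKpos : ∀ k, 1 ≤ k → 0 < ∑ j, (localK n k j : ℝ) := fun k hk =>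
    Finset.sum_pos (fun j _ => by exact_mod_cast localK_pos hn hk j) Finset.univ_nonempty
  -- Up to `ks` all selected points lie in the ball, so the conditional means contribute at least `t
  -- / 2` each towards side `σ`, and label noise takes away less than `√(K L / 2)`.
  have main : ∀ k, 1 ≤ k → k ≤ ks → (∑ j, (localK n k j : ℝ)) * (t / 2) -
      √((∑ j, (localK n k j : ℝ)) * L / 2) <
        (∑ j, (localK n k j : ℝ)) * (σ * (distEstimate (localK n k) z x - 1 / 2)) := by
    intro k hk1 hk2
    have hc : ((selected (localK n k) x z).card : ℝ) = ∑ j, (localK n k j : ℝ) := by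
      rw [card_selected (localK_le hn k (hk2.trans hks0))]
      push_cast
      rfl
    have h1 := sum_mul_distEstimate (localK_pos hn hk1) x z
    have h2 : ((selected (localK n k) x z).card : ℝ) * (t / 2) ≤
        ∑ p ∈ selected (localK n k) x z, σ * (f (z p).1 - 1 / 2) := by
      rw [← nsmul_eq_mul]
      refine Finset.card_nsmul_le_sum _ _ _ fun p hp => ?_
      have hd := hclose p (dist_lt_of_mem_selected hp
        ((localK_mono hk2 p.1).trans (hcount p.1)))
      have hd' : |σ * (f (z p).1 - f x)| ≤ t / 2 := by rwa [abs_mul, hσ, one_mul]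
      have := (abs_le.1 hd').1
      linarith
    have h3 := hdev k hk1 (hk2.trans hks0)
    rw [← Finset.mul_sum, Finset.sum_sub_distrib, Finset.sum_const, nsmul_eq_mul, hc] at h2
    rw [Finset.sum_sub_distrib, ← h1] at h3
    linear_combination h2 + h3
  -- The signal test is put on the scale of the label sum, where its threshold coincides with the
  -- noise bound.
  have hsq : ∀ K : ℝ, 0 < K → ∀ u : ℝ, √L < √(2 * K) * |u| ↔ √(K * L / 2) < K * |u| := by
    intro K hK u
    have e : √(K * L / 2) * √(2 * K) = K * √L := by
      rw [← Real.sqrt_mul (by positivity), show K * L / 2 * (2 * K) = K ^ 2 * L by ring,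
        Real.sqrt_mul (by positivity), Real.sqrt_sq hK.le]
    have h2K : 0 < √(2 * K) := Real.sqrt_pos.2 (by positivity)
    rw [← mul_lt_mul_iff_right₀ hK, ← mul_lt_mul_iff_left₀ h2K (b := √(K * L / 2)), e,
      show K * (√(2 * K) * |u|) = K * |u| * √(2 * K) by ring]
  have hlast : √((∑ j, (localK n ks j : ℝ)) * L / 2) <
      (∑ j, (localK n ks j : ℝ)) * (σ * (distEstimate (localK n ks) z x - 1 / 2)) := by
    have hK := hKpos ks hks1
    have hm := main ks hks1 le_rfl
    have hKN : κ * totalSize n ≤ ∑ j, (localK n ks j : ℝ) := by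
      rw [totalSize, Nat.cast_sum, Finset.mul_sum]
      refine Finset.sum_le_sum fun j _ => ?_
      refine le_trans ?_ (Nat.le_ceil _)
      rw [le_div_iff₀ h0]
      have := Nat.le_ceil (κ * n 0)
      calc κ * n j * n 0 = κ * n 0 * n j := by ring
        _ ≤ _ := by gcongr
    -- `√(K L / 2) < K t / 4` amounts to `8 L < K t ^ 2`; the factor `9` in `hsig` gives the strict
    -- inequality. The margin `K t / 2` thus exceeds twice the noise.
    set K := ∑ j, (localK n ks j : ℝ)
    have hq : √(K * L / 2) < K * t / 4 := by
      rw [Real.sqrt_lt' (by positivity)]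
      have : 9 * L ≤ K * t ^ 2 := hsig.trans (by gcongr)
      nlinarith [mul_le_mul_of_nonneg_left this hK.le, mul_pos hK hLpos]
    linarith
  have habs : ∀ u : ℝ, |σ * u| = |u| := fun u => by rw [abs_mul, hσ, one_mul]
  obtain ⟨hk1, hk2⟩ : 1 ≤ adaptiveK z x ∧ Stops z x (adaptiveK z x) :=
    Nat.find_spec (exists_stops z x)
  have hle : adaptiveK z x ≤ ks := by
    refine Nat.find_min' (exists_stops z x) ⟨hks1, Or.inl ?_⟩
    rw [signal, hsq _ (hKpos ks hks1), ← habs]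
    exact hlast.trans_le (mul_le_mul_of_nonneg_left (le_abs_self _) (hKpos ks hks1).le)
  set k := adaptiveK z x
  have hK := hKpos k hk1
  -- A signal on the wrong side would need noise beyond its bound. An early stop can only occur at
  -- `ks` itself, since a smaller `k` is below `κ * n 0`, hence below the early stopping bound.
  rcases hk2 with hk2 | hk2
  · rw [signal, hsq _ hK, ← habs] at hk2
    have hm := main k hk1 hle
    set K := ∑ j, (localK n k j : ℝ)
    set u := σ * (distEstimate (localK n k) z x - 1 / 2)
    have : 0 < K * (t / 2) := by positivity
    by_contra! hu
    rw [abs_of_nonpos hu] at hk2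
    linarith
  · rcases hle.eq_or_lt with he | hlt
    · rw [he]
      have h1 : 0 ≤ √((∑ j, (localK n ks j : ℝ)) * L / 2) := Real.sqrt_nonneg _
      exact pos_of_mul_pos_right (h1.trans_lt hlast) (hKpos ks hks1).le
    · have h1 := Nat.lt_ceil.1 hlt
      unfold earlyStop at hk2
      have h2 : κ * n 0 < n 0 * ((totalSize n : ℝ) ^ (-((d : ℝ) / (2 + d))) *
          Real.log (totalSize n)) := by
        rw [mul_comm]; gcongr
      linarith

end Deterministic

/-! ### Error probability at a fixed query -/

section FixedQuery

variable {d m : ℕ} {n : Fin m → ℕ}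

theorem ae_pi_forall {ι Z : Type*} [Fintype ι] [MeasurableSpace Z] (P : Measure Z)
    [IsProbabilityMeasure P] {Q : Z → Prop} (h : ∀ᵐ w ∂P, Q w) :
    ∀ᵐ z ∂(Measure.pi fun _ : ι => P), ∀ i, Q (z i) :=
  ae_all_iff.2 fun i =>
    (measurePreserving_eval (fun _ : ι => P) i).quasiMeasurePreserving.ae h

theorem measure_few_neighbors_le (P : Measure (Obs d)) [IsProbabilityMeasure P] (x : Feature d)
    {r p : ℝ} (hp : ENNReal.ofReal p ≤ P {w | dist w.1 x < r}) (j : Fin m) :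
    (Measure.pi fun _ : (Σ j : Fin m, Fin (n j)) => P)
      {z | ((#{i : Fin (n j) | dist (z ⟨j, i⟩).1 x < r} : ℕ) : ℝ) ≤ n j * p / 2} ≤
      ENNReal.ofReal (Real.exp (-(n j * p / 10))) := by
  classical
  have hB : MeasurableSet {w : Obs d | dist w.1 x < r} :=
    measurableSet_lt (measurable_fst.dist measurable_const) measurable_const
  have h := measure_card_filter_le P
    (Finset.univ.map (Function.Embedding.sigmaMk (β := fun j => Fin (n j)) j)) hB hp
  rw [Finset.card_map, Finset.card_univ, Fintype.card_fin] at h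
  refine le_trans (le_of_eq ?_) h
  congr 1
  ext z
  simp only [Set.mem_ofPred_eq]
  rw [Finset.filter_map, Finset.card_map]
  simp

variable [NeZero m]

/-- The deviation `s = √(K L / 2)` solves `2 s ^ 2 / K = L`. Here means minus labels are summed, so
Hoeffding is applied with sign `-σ`. -/
theorem measure_label_deviation_le (P : Measure (Obs d)) [IsProbabilityMeasure P] (x : Feature d)
    {σ : ℝ} (hσ : |σ| = 1) (hn : ∀ j, 0 < n j) {L : ℝ} (hL : 0 ≤ L) {k : ℕ} (hk : 1 ≤ k)
    (hkn : k ≤ n 0) :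
    (Measure.pi fun _ : (Σ j : Fin m, Fin (n j)) => P)
      {z | √((∑ j, (localK n k j : ℝ)) * L / 2) ≤ σ * ∑ p ∈ selected (localK n k) x z,
        ((P.condKernel (z p).1).real {1} - (((z p).2 : ℕ) : ℝ))} ≤
      ENNReal.ofReal (Real.exp (-L)) := by
  have hK : 0 < ∑ j, localK n k j :=
    Finset.sum_pos (fun j _ => localK_pos hn hk j) Finset.univ_nonempty
  have hK' : (0 : ℝ) < ∑ j, (localK n k j : ℝ) := by exact_mod_cast hK
  have hσ2 : (-σ) ^ 2 = 1 := by rw [neg_sq, ← sq_abs, hσ, one_pow]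
  have hsel : ∀ p : (Σ j : Fin m, Fin (n j)),
      MeasurableSet {z : Dataset d n | p ∈ selected (localK n k) x z} := by
    intro p
    have hx : Measurable fun z : Dataset d n => (z, x) := measurable_id.prodMk measurable_const
    exact hx (measurableSet_mem_selected (localK n k) p)
  have h := measure_selected_sum_ge_le P (selected (localK n k) x) hsel
    (fun z z' hz => selected_congr _ x hz) hK (card_selected (localK_le hn k hkn) x) hσ2
    (Real.sqrt_nonneg ((∑ j, (localK n k j : ℝ)) * L / 2))
  rw [Real.sq_sqrt (by positivity)] at h
  have e : 2 * ((∑ j, (localK n k j : ℝ)) * L / 2) / ((∑ j, localK n k j : ℕ) : ℝ) = L := by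
    push_cast
    field_simp
  rw [e] at h
  refine le_trans (le_of_eq ?_) h
  congr 1
  ext z
  simp only [Set.mem_ofPred_eq, Finset.sum_sub_distrib]
  ring_nf

/-- Probability that the adaptive estimator is on the wrong side of `1/2` at the query `x`. -/
theorem measure_adaptive_wrong_side_le (P : Measure (Obs d)) [IsProbabilityMeasure P]
    (x : Feature d) (hn : ∀ j, 0 < n j) {σ : ℝ} (hσ : |σ| = 1) {t r κ p : ℝ} (ht : 0 < t)
    (hκ : 0 < κ) (hx : t ≤ σ * ((P.condKernel x).real {1} - 1 / 2))
    (hclose : ∀ᵐ w ∂P, dist w.1 x < r →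
      |(P.condKernel w.1).real {1} - (P.condKernel x).real {1}| ≤ t / 2)
    (hp : ENNReal.ofReal p ≤ P {w | dist w.1 x < r})
    (hk : ∀ j, (localK n ⌈κ * n 0⌉₊ j : ℝ) ≤ n j * p / 2)
    (hL : 0 < Real.log (totalSize n))
    (hsig : 9 * (((d : ℝ) + 2) * Real.log (totalSize n)) ≤ κ * totalSize n * t ^ 2)
    (hκN : κ < (totalSize n : ℝ) ^ (-((d : ℝ) / (2 + d))) * Real.log (totalSize n)) :
    (Measure.pi fun _ : (Σ j : Fin m, Fin (n j)) => P)
      {z | σ * (distEstimate (localK n (adaptiveK z x)) z x - 1 / 2) ≤ 0} ≤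
      ENNReal.ofReal (n 0 * Real.exp (-(((d : ℝ) + 2) * Real.log (totalSize n))) +
        ∑ j, Real.exp (-(n j * p / 10))) := by
  set L : ℝ := ((d : ℝ) + 2) * Real.log (totalSize n) with hLdef
  have hL0 : 0 ≤ L := by positivity
  set μ := Measure.pi fun _ : (Σ j : Fin m, Fin (n j)) => P with hμ
  set D : ℕ → Set (Dataset d n) := fun k => {z | √((∑ j, (localK n k j : ℝ)) * L / 2) ≤
    σ * ∑ p ∈ selected (localK n k) x z,
      ((P.condKernel (z p).1).real {1} - (((z p).2 : ℕ) : ℝ))} with hD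
  set F : Fin m → Set (Dataset d n) := fun j =>
    {z | ((#{i : Fin (n j) | dist (z ⟨j, i⟩).1 x < r} : ℕ) : ℝ) ≤ n j * p / 2} with hF
  have hae := ae_pi_forall (ι := Σ j : Fin m, Fin (n j)) P hclose
  -- The inclusion is only almost sure because `hclose` is. All `k ≤ n 0` are included, as the good
  -- event forces `⌈κ * n 0⌉₊ ≤ n 0`.
  have hsub : ({z | σ * (distEstimate (localK n (adaptiveK z x)) z x - 1 / 2) ≤ 0} :
      Set (Dataset d n)) ≤ᵐ[μ] ((⋃ k ∈ Finset.Icc 1 (n 0), D k) ∪ ⋃ j, F j : Set (Dataset d n)) := by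
    filter_upwards [hae] with z hz hzle
    by_contra hnot
    have hnot' : z ∉ ((⋃ k ∈ Finset.Icc 1 (n 0), D k) ∪ ⋃ j, F j : Set (Dataset d n)) := hnot
    simp only [Set.mem_union, Set.mem_iUnion, not_or, not_exists, Finset.mem_Icc, hD, hF,
      Set.mem_ofPred_eq, not_le] at hnot'
    refine absurd (adaptive_estimate_sign hn z x hσ (fun y => (P.condKernel y).real {1}) ht hκ hx
      hz (fun j => ?_) (fun k h1 h2 => hnot'.1 k ⟨h1, h2⟩) hL hsig hκN) (not_lt.2 hzle)
    exact_mod_cast (hk j).trans (hnot'.2 j).le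
  refine (measure_mono_ae hsub).trans ((measure_union_le _ _).trans ?_)
  rw [ENNReal.ofReal_add (by positivity) (by positivity),
    ENNReal.ofReal_sum_of_nonneg fun _ _ => (Real.exp_pos _).le]
  refine add_le_add ?_ ?_
  · refine (measure_biUnion_finset_le _ _).trans ?_
    refine (Finset.sum_le_card_nsmul _ _ (ENNReal.ofReal (Real.exp (-L))) fun k hk => ?_).trans ?_
    · rw [Finset.mem_Icc] at hk
      exact measure_label_deviation_le P x hσ hn hL0 hk.1 hk.2
    · rw [Nat.card_Icc, Nat.add_sub_cancel, nsmul_eq_mul,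
        ENNReal.ofReal_mul (Nat.cast_nonneg _), ENNReal.ofReal_natCast]
  · refine (measure_iUnion_fintype_le _ _).trans (Finset.sum_le_sum fun j _ => ?_)
    exact measure_few_neighbors_le P x hp j

/-- The two signs of `η x - 1/2` are treated separately. The value `1/2` counts as an error on
either side, so the tie convention of `plugIn` is harmless. -/
theorem measure_adaptiveClassifier_ne_le (P : Measure (Obs d)) [IsProbabilityMeasure P]
    (x : Feature d) (hn : ∀ j, 0 < n j) {t r κ p : ℝ} (ht : 0 < t)
    (hκ : 0 < κ) (hx : t ≤ |(P.condKernel x).real {1} - 1 / 2|)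
    (hclose : ∀ᵐ w ∂P, dist w.1 x < r →
      |(P.condKernel w.1).real {1} - (P.condKernel x).real {1}| ≤ t / 2)
    (hp : ENNReal.ofReal p ≤ P {w | dist w.1 x < r})
    (hk : ∀ j, (localK n ⌈κ * n 0⌉₊ j : ℝ) ≤ n j * p / 2)
    (hL : 0 < Real.log (totalSize n))
    (hsig : 9 * (((d : ℝ) + 2) * Real.log (totalSize n)) ≤ κ * totalSize n * t ^ 2)
    (hκN : κ < (totalSize n : ℝ) ^ (-((d : ℝ) / (2 + d))) * Real.log (totalSize n)) :
    (Measure.pi fun _ : (Σ j : Fin m, Fin (n j)) => P)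
      {z | adaptiveClassifier z x ≠ plugIn (fun y => (P.condKernel y).real {1}) x} ≤
      ENNReal.ofReal (n 0 * Real.exp (-(((d : ℝ) + 2) * Real.log (totalSize n))) +
        ∑ j, Real.exp (-(n j * p / 10))) := by
  rcases le_abs.1 hx with h | h
  · refine le_trans (measure_mono fun z hz => ?_) (measure_adaptive_wrong_side_le P x hn
      (σ := 1) (by simp) ht hκ (by simpa using h) hclose hp hk hL hsig hκN)
    by_contra hlt
    simp only [Set.mem_ofPred_eq, not_le, one_mul] at hlt
    refine hz ?_
    rw [adaptiveClassifier, plugIn, plugIn, if_pos (by linarith), if_pos (by linarith)]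
  · refine le_trans (measure_mono fun z hz => ?_) (measure_adaptive_wrong_side_le P x hn
      (σ := -1) (by simp) ht hκ (by linarith) hclose hp hk hL hsig hκN)
    by_contra hlt
    simp only [Set.mem_ofPred_eq, not_le] at hlt
    refine hz ?_
    rw [adaptiveClassifier, plugIn, plugIn, if_neg (by linarith), if_neg (by linarith)]

end FixedQuery

/-! ### From pointwise errors to regret -/

section Regret

variable {d : ℕ} {ι : Type*} [Fintype ι]

theorem plugIn_congr {η η' : Feature d → ℝ} {x : Feature d} (h : η x = η' x) :
    plugIn η x = plugIn η' x := by
  simp only [plugIn, h]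

theorem ae_fst_of_ae {P : Measure (Obs d)} {Q : Feature d → Prop} (h : ∀ᵐ x ∂P.fst, Q x) :
    ∀ᵐ z ∂P, Q z.1 :=
  ae_of_ae_map measurable_fst.aemeasurable h

theorem measurable_plugIn {η : Feature d → ℝ} (h : Measurable η) : Measurable (plugIn η) :=
  Measurable.ite (measurableSet_le measurable_const h) measurable_const measurable_const

/-- Excess risk at `x` of a random label with distribution `μ {z | g z ≠ ·}`. -/
theorem lintegral_error_le {Z : Type*} [MeasurableSpace Z] (μ : Measure Z) [IsProbabilityMeasure μ]
    {g : Z → Fin 2} (hg : Measurable g) (ν : Measure (Fin 2)) [IsProbabilityMeasure ν]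
    {t δ : ℝ} (ht : 0 ≤ t) (hδ : 0 ≤ δ) (b : Fin 2) (hb : b = if 1 / 2 ≤ ν.real {1} then 1 else 0)
    (hw : t ≤ |ν.real {1} - 1 / 2| → μ {z | g z ≠ b} ≤ ENNReal.ofReal δ) :
    ∫⁻ y, μ {z | g z ≠ y} ∂ν ≤ ν {y | b ≠ y} +
      (ENNReal.ofReal (2 * t) * (if |ν.real {1} - 1 / 2| < t then 1 else 0) +
        ENNReal.ofReal δ) := by
  have hS : ∀ y, MeasurableSet {z | g z ≠ y} := fun y =>
    (hg (measurableSet_singleton y)).compl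
  have e01 : {z | g z ≠ (1 : Fin 2)} = {z | g z ≠ 0}ᶜ := by
    ext z
    simp only [Set.mem_ofPred_eq, Set.mem_compl_iff]
    generalize g z = a
    fin_cases a <;> simp
  have eb0 : {y : Fin 2 | (0 : Fin 2) ≠ y} = {1} := by ext y; fin_cases y <;> simp
  have eb1 : {y : Fin 2 | (1 : Fin 2) ≠ y} = {0} := by ext y; fin_cases y <;> simp
  have e0 : ({0} : Set (Fin 2)) = {1}ᶜ := by ext y; fin_cases y <;> simp
  have hν0 : ν.real {0} = 1 - ν.real {1} := by
    rw [e0, probReal_compl_eq_one_sub (measurableSet_singleton _)]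
  have hμ1 : μ.real {z | g z ≠ 1} = 1 - μ.real {z | g z ≠ 0} := by
    rw [e01, probReal_compl_eq_one_sub (hS 0)]
  have ha0 : 0 ≤ μ.real {z | g z ≠ 0} := measureReal_nonneg
  have ha1 : μ.real {z | g z ≠ 0} ≤ 1 := measureReal_le_one
  have hf0 : 0 ≤ ν.real {1} := measureReal_nonneg
  have hf1 : ν.real {1} ≤ 1 := measureReal_le_one
  rw [lintegral_fintype, Fin.sum_univ_two]
  have hμr : ∀ s, μ s = ENNReal.ofReal (μ.real s) := fun s => (ofReal_measureReal).symm
  have hνr : ∀ s, ν s = ENNReal.ofReal (ν.real s) := fun s => (ofReal_measureReal).symm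
  simp only [hμr, hνr] at hw ⊢
  rw [← ENNReal.ofReal_mul measureReal_nonneg, ← ENNReal.ofReal_mul measureReal_nonneg,
    ← ENNReal.ofReal_add (by positivity) (by positivity), hμ1, hν0]
  rw [ENNReal.ofReal_le_ofReal_iff hδ] at hw
  have hI : ENNReal.ofReal (2 * t) * (if |ν.real {1} - 1 / 2| < t then 1 else 0) =
      ENNReal.ofReal (if |ν.real {1} - 1 / 2| < t then 2 * t else 0) := by
    split_ifs <;> simp
  have hI0 : 0 ≤ if |ν.real {1} - 1 / 2| < t then 2 * t else 0 := by
    split_ifs <;> positivity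
  rw [hI, ← ENNReal.ofReal_add hI0 hδ, ← ENNReal.ofReal_add measureReal_nonneg (by positivity)]
  refine ENNReal.ofReal_le_ofReal ?_
  set a := μ.real {z | g z ≠ 0}
  set f := ν.real {1}
  -- In both cases the excess risk is `2 |f - 1/2|` times the probability of missing `b`. It is
  -- below `2 t` near the boundary; elsewhere `2 |f - 1/2| ≤ 1` leaves `δ`.
  by_cases hf : 1 / 2 ≤ f
  · rw [if_pos hf] at hb
    subst hb
    rw [eb1, hν0]
    rw [hμ1] at hw
    rw [abs_of_nonneg (by linarith)] at hw ⊢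
    split_ifs with h
    · nlinarith
    · have := hw (not_lt.1 h)
      nlinarith
  · rw [if_neg hf] at hb
    subst hb
    rw [eb0]
    rw [abs_of_neg (by linarith)] at hw ⊢
    split_ifs with h
    · nlinarith
    · have := hw (not_lt.1 h)
      nlinarith

/-- A classifier that agrees with the Bayes classifier up to probability `δ` wherever `η` is at
distance at least `t` from `1/2` has a small regret. -/
theorem regret_le (P : Measure (Obs d)) [IsProbabilityMeasure P] {η : Feature d → ℝ}
    (hη : IsRegressionFunction P η) {g : (ι → Obs d) → Feature d → Fin 2}
    (hg : Measurable fun q : (ι → Obs d) × Feature d => g q.1 q.2) {t δ : ℝ} (ht : 0 ≤ t)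
    (hδ : 0 ≤ δ)
    (hw : ∀ᵐ x ∂P.fst, t ≤ |(P.condKernel x).real {1} - 1 / 2| →
      (Measure.pi fun _ : ι => P) {z | g z x ≠ plugIn (fun y => (P.condKernel y).real {1}) x} ≤
        ENNReal.ofReal δ) :
    regret P η g ≤ 2 * t * P.fst.real {x | |η x - 1 / 2| < t} + δ := by
  set f : Feature d → ℝ := fun y => (P.condKernel y).real {1} with hf
  -- `η` is pinned down only almost everywhere, so it is exchanged for the measurable version `f`.
  have hfm : Measurable f := measurable_condKernel_real P
  set μ := Measure.pi fun _ : ι => P with hμ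
  have e1 : P.fst.real {x | |η x - 1 / 2| < t} = P.fst.real {x | |f x - 1 / 2| < t} := by
    refine measureReal_congr (Filter.eventuallyEq_set.2 ?_)
    filter_upwards [hη] with x hx
    simp only [hx, hf]
  have e2 : P.real {z | plugIn η z.1 ≠ z.2} = P.real {z | plugIn f z.1 ≠ z.2} := by
    refine measureReal_congr (Filter.eventuallyEq_set.2 ?_)
    filter_upwards [ae_fst_of_ae hη] with z hz
    simp only [plugIn_congr (η' := f) hz]
  have hbm : MeasurableSet {z : Obs d | plugIn f z.1 ≠ z.2} :=
    (measurableSet_eq_fun ((measurable_plugIn hfm).comp measurable_fst) measurable_snd).compl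
  have hgq : Measurable fun ω : (ι → Obs d) × Obs d => g ω.1 ω.2.1 :=
    hg.comp (measurable_fst.prodMk (measurable_fst.comp measurable_snd))
  have hW : MeasurableSet {ω : (ι → Obs d) × Obs d | g ω.1 ω.2.1 ≠ ω.2.2} :=
    (measurableSet_eq_fun hgq (measurable_snd.comp measurable_snd)).compl
  have hA : MeasurableSet {x | |f x - 1 / 2| < t} :=
    measurableSet_lt ((hfm.sub_const _).abs) measurable_const
  have key : (μ.prod P) {ω | g ω.1 ω.2.1 ≠ ω.2.2} ≤ P {z | plugIn f z.1 ≠ z.2} +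
      (ENNReal.ofReal (2 * t) * P.fst {x | |f x - 1 / 2| < t} + ENNReal.ofReal δ) := by
    have hm1 : Measurable fun z : Obs d => μ {ω | g ω z.1 ≠ z.2} :=
      measurable_measure_prodMk_right hW
    have h1 : (μ.prod P) {ω | g ω.1 ω.2.1 ≠ ω.2.2} = ∫⁻ z, μ {ω | g ω z.1 ≠ z.2} ∂P :=
      Measure.prod_apply_symm hW
    have h2 : P {z | plugIn f z.1 ≠ z.2} =
        ∫⁻ x, P.condKernel x {y | plugIn f x ≠ y} ∂P.fst := by
      conv_lhs => rw [← P.disintegrate P.condKernel]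
      exact Measure.compProd_apply hbm
    have h3 : ENNReal.ofReal (2 * t) * P.fst {x | |f x - 1 / 2| < t} =
        ∫⁻ x, ENNReal.ofReal (2 * t) * (if |f x - 1 / 2| < t then 1 else 0) ∂P.fst := by
      have : ∀ x, (if |f x - 1 / 2| < t then (1 : ENNReal) else 0) =
          {x | |f x - 1 / 2| < t}.indicator 1 x := fun x => by simp [Set.indicator_apply]
      simp only [this]
      rw [lintegral_const_mul _ (measurable_one.indicator hA), lintegral_indicator_one hA]
    have hmk : Measurable fun x => P.condKernel x {y | plugIn f x ≠ y} :=
      Kernel.measurable_kernel_prodMk_left hbm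
    have hmi : Measurable fun x =>
        ENNReal.ofReal (2 * t) * (if |f x - 1 / 2| < t then (1 : ENNReal) else 0) :=
      (Measurable.ite hA measurable_const measurable_const).const_mul _
    have h4 : ENNReal.ofReal δ = ∫⁻ _, ENNReal.ofReal δ ∂P.fst := by simp
    rw [h1, lintegral_disintegrate P hm1, h2, h3, h4, ← lintegral_add_left hmi,
      ← lintegral_add_left hmk]
    refine lintegral_mono_ae ?_
    filter_upwards [hw] with x hx
    exact lintegral_error_le μ (g := fun z => g z x) (hg.comp measurable_prodMk_right)
      (P.condKernel x) ht hδ (plugIn f x) rfl hx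
  have hfin := ENNReal.toReal_mono (by finiteness) key
  rw [ENNReal.toReal_add (by finiteness) (by finiteness),
    ENNReal.toReal_add (by finiteness) (by finiteness), ENNReal.toReal_mul,
    ENNReal.toReal_ofReal (by positivity), ENNReal.toReal_ofReal hδ] at hfin
  rw [regret, e1, e2]
  simp only [Measure.real] at hfin ⊢
  linarith

end Regret

/-! ### Choice of the radius and asymptotics -/

open Filter Topology

theorem tendsto_log_div_nat : Tendsto (fun N : ℕ => Real.log N / N) atTop (𝓝 0) := by
  have h := (Real.isLittleO_log_id_atTop.tendsto_div_nhds_zero).comp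
    (tendsto_natCast_atTop_atTop (R := ℝ))
  exact h

/-- The first bound on `E` will keep the neighbor fraction `κ` below a quarter of the ball mass, the
second below the early stopping fraction. -/
theorem exists_radius_constant {a β s : ℝ} (hβ : 0 < β) (hs : 0 < s) (a' : ℝ) :
    ∃ E : ℝ, 0 < E ∧ a ≤ E ^ s ∧ a' < E ^ (2 * β) := by
  have h1 := (tendsto_rpow_atTop hs).eventually_ge_atTop a
  have h2 := (tendsto_rpow_atTop (by positivity : 0 < 2 * β)).eventually_gt_atTop a'
  obtain ⟨E, h⟩ := ((eventually_gt_atTop 0).and (h1.and h2)).exists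
  exact ⟨E, h⟩

/-- Asymptotic relations between the sample size, the radius `r`, the margin `t = 2 C r ^ β` and the
fraction `A log N / (N t ^ 2)` of neighbors. -/
theorem eventually_radius_bounds {d : ℕ} {β C A b c ε rl E : ℝ} (hβ : 0 < β)
    (hβ1 : β ≤ 1) (hC : 0 < C) (hA : 0 < A) (hb : 0 < b) (hc : 0 < c)
    (hε : ε < 2 * β / (2 * β + d)) (hrl : 0 < rl) (hE : 0 < E)
    (hE1 : A / (C ^ 2 * b) ≤ E ^ (2 * β + d)) (hE2 : A / (4 * C ^ 2) < E ^ (2 * β)) :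
    ∀ᶠ N : ℕ in atTop, 3 ≤ N ∧ 1 ≤ Real.log N ∧ ∀ r t : ℝ,
      r = E * (Real.log N / N) ^ (1 / (2 * β + d)) → t = 2 * C * r ^ β →
      r < rl ∧ t ≤ 1 / 2 ∧ A * Real.log N / (N * t ^ 2) ≤ b * r ^ d / 4 ∧
      A * Real.log N / (N * t ^ 2) < (N : ℝ) ^ (-((d : ℝ) / (2 + d))) * Real.log N ∧
      20 * Real.log N ≤ c * (N : ℝ) ^ (1 - ε) * (b * r ^ d) := by
  have hs : 0 < 2 * β + d := by positivity
  have hr0 : Tendsto (fun N : ℕ => E * (Real.log N / N) ^ (1 / (2 * β + d))) atTop (𝓝 0) := by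
    have := (tendsto_log_div_nat.rpow_const (p := 1 / (2 * β + d))
      (Or.inr (by positivity))).const_mul E
    rwa [Real.zero_rpow (by positivity), mul_zero] at this
  have ht0 : Tendsto (fun N : ℕ => 2 * C * (E * (Real.log N / N) ^ (1 / (2 * β + d))) ^ β)
      atTop (𝓝 0) := by
    have := (hr0.rpow_const (p := β) (Or.inr hβ.le)).const_mul (2 * C)
    rwa [Real.zero_rpow hβ.ne', mul_zero] at this
  -- This is the hypothesis on `ε`: `N ^ (1 - ε) * r ^ d` grows at least like a positive power of
  -- `N` and beats `log N`.
  have hγ : 0 < 1 - ε - d / (2 * β + d) := by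
    have : 2 * β / (2 * β + d) = 1 - d / (2 * β + d) := by field_simp; ring
    linarith
  have hlog : ∀ᶠ N : ℕ in atTop, 20 * Real.log N ≤
      c * b * E ^ d * (N : ℝ) ^ (1 - ε - d / (2 * β + d)) := by
    have h1 := (isLittleO_log_rpow_atTop hγ).bound
      (by positivity : 0 < c * b * E ^ d / 20)
    filter_upwards [(tendsto_natCast_atTop_atTop (R := ℝ)).eventually h1] with N hN
    rw [Real.norm_of_nonneg (Real.rpow_nonneg (Nat.cast_nonneg _) _)] at hN
    have := (le_abs_self _).trans hN
    linarith
  filter_upwards [eventually_ge_atTop 3, hr0.eventually_lt_const hrl,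
    ht0.eventually_lt_const (by norm_num : (0 : ℝ) < 1 / 2), hlog,
    (Real.tendsto_log_atTop.comp (tendsto_natCast_atTop_atTop (R := ℝ))).eventually_ge_atTop 1]
    with N hN3 hr ht hl hlog1
  simp only [Function.comp_apply] at hlog1
  refine ⟨hN3, hlog1, ?_⟩
  rintro r t rfl rfl
  have hN : (0 : ℝ) < N := by positivity
  have hN1 : (1 : ℝ) ≤ N := by exact_mod_cast (by omega : 1 ≤ N)
  set ρ : ℝ := Real.log N / N with hρ
  have hlpos : 0 < Real.log N := by linarith
  have hρ0 : 0 < ρ := by positivity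
  have hρN : (N : ℝ)⁻¹ ≤ ρ := by
    rw [hρ, inv_eq_one_div]
    gcongr
  set r : ℝ := E * ρ ^ (1 / (2 * β + d)) with hrdef
  have hrpos : 0 < r := by positivity
  have hrpow : ∀ q : ℝ, r ^ q = E ^ q * ρ ^ (q / (2 * β + d)) := by
    intro q
    rw [hrdef, Real.mul_rpow hE.le (by positivity), ← Real.rpow_mul hρ0.le]
    ring_nf
  have hρinv : ∀ q : ℝ, 0 ≤ q → (N : ℝ) ^ (-q) ≤ ρ ^ q := by
    intro q hq
    rw [Real.rpow_neg hN.le, ← Real.inv_rpow hN.le]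
    exact Real.rpow_le_rpow (by positivity) hρN hq
  have ht2 : (2 * C * r ^ β) ^ 2 = 4 * C ^ 2 * r ^ (2 * β) := by
    rw [mul_comm 2 β, Real.rpow_mul hrpos.le, Real.rpow_two]
    ring
  have hκ : A * Real.log N / (N * (2 * C * r ^ β) ^ 2) = A * ρ / (4 * C ^ 2 * r ^ (2 * β)) := by
    rw [ht2, hρ]
    field_simp
  have hr2 : 0 < r ^ (2 * β) := by positivity
  rw [hκ]
  refine ⟨hr, ht.le, ?_, ?_, ?_⟩
  · rw [div_le_iff₀ (by positivity)]
    -- Bias-variance balance: ball mass times squared margin is of order `log N / N`.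
    have e : r ^ d * r ^ (2 * β) = E ^ (2 * β + d) * ρ := by
      rw [← Real.rpow_natCast, ← Real.rpow_add hrpos, add_comm, hrpow, div_self hs.ne',
        Real.rpow_one]
    rw [div_le_iff₀ (by positivity)] at hE1
    calc A * ρ ≤ E ^ (2 * β + d) * (C ^ 2 * b) * ρ := by gcongr
      _ = C ^ 2 * b * (r ^ d * r ^ (2 * β)) := by rw [e]; ring
      _ = _ := by ring
  · have h1 : A < 4 * C ^ 2 * E ^ (2 * β) := by
      rw [div_lt_iff₀ (by positivity)] at hE2
      linarith
    -- The early stopping bound is tuned to smoothness `1`; for `β ≤ 1` one has `2β / (2β + d) ≤ 2 /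
    -- (2 + d)`.
    have h2 : (N : ℝ) ^ (-(2 / (2 + d) : ℝ)) ≤ ρ ^ (2 * β / (2 * β + d)) := by
      refine le_trans ?_ (hρinv _ (by positivity))
      refine Real.rpow_le_rpow_of_exponent_le hN1 (neg_le_neg ?_)
      rw [div_le_div_iff₀ hs (by positivity)]
      nlinarith [Nat.cast_nonneg (α := ℝ) d]
    have h3 : (N : ℝ)⁻¹ = (N : ℝ) ^ (-(2 / (2 + d) : ℝ)) * (N : ℝ) ^ (-((d : ℝ) / (2 + d))) := by
      rw [← Real.rpow_add hN, ← Real.rpow_neg_one]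
      congr 1
      field_simp
      ring
    rw [div_lt_iff₀ (by positivity), hrpow]
    calc A * ρ = A * (N : ℝ) ^ (-(2 / (2 + d) : ℝ)) * ((N : ℝ) ^ (-((d : ℝ) / (2 + d))) *
          Real.log N) := by rw [hρ, div_eq_mul_inv, h3]; ring
      _ < 4 * C ^ 2 * E ^ (2 * β) * (N : ℝ) ^ (-(2 / (2 + d) : ℝ)) *
          ((N : ℝ) ^ (-((d : ℝ) / (2 + d))) * Real.log N) := by gcongr
      _ ≤ 4 * C ^ 2 * E ^ (2 * β) * ρ ^ (2 * β / (2 * β + d)) *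
          ((N : ℝ) ^ (-((d : ℝ) / (2 + d))) * Real.log N) := by gcongr
      _ = _ := by ring
  · refine hl.trans ?_
    have e : r ^ d = E ^ d * ρ ^ ((d : ℝ) / (2 * β + d)) := by
      rw [← Real.rpow_natCast, hrpow, Real.rpow_natCast]
    rw [e, sub_eq_add_neg (1 - ε), Real.rpow_add hN]
    calc _ = c * (N : ℝ) ^ (1 - ε) * (b * (E ^ d * (N : ℝ) ^ (-((d : ℝ) / (2 * β + d))))) := by ring
      _ ≤ _ := by
        gcongr
        exact hρinv _ (by positivity)

/-! ### Ball mass, rounding and tail sums -/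

/-- The strong density condition bounds the mass of small balls from below. -/
theorem StrongDensity.le_measure_ball {d : ℕ} (hd : 1 ≤ d) {μ : Measure (Feature d)} {c r₀ : ℝ}
    (h : StrongDensity μ c r₀) (hc : 0 ≤ c) {x : Feature d} (hx : x ∈ μ.support) {r : ℝ}
    (hr : 0 < r) (hr₀ : r < r₀) :
    ENNReal.ofReal (c ^ 2 * (√Real.pi ^ d / Real.Gamma (d / 2 + 1)) * r ^ d) ≤
      μ (Metric.ball x r) := by
  have : Nonempty (Fin d) := ⟨⟨0, hd⟩⟩
  obtain ⟨p, hp, hμ, hpd⟩ := h.density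
  have hS : MeasurableSet (μ.support ∩ Metric.ball x r) :=
    Measure.isClosed_support.measurableSet.inter measurableSet_ball
  have hΓ : 0 ≤ √Real.pi ^ d / Real.Gamma (d / 2 + 1) :=
    div_nonneg (by positivity) (Real.Gamma_pos_of_pos (by positivity)).le
  calc ENNReal.ofReal (c ^ 2 * (√Real.pi ^ d / Real.Gamma (d / 2 + 1)) * r ^ d)
      = ENNReal.ofReal c * (ENNReal.ofReal c * volume (Metric.ball x r)) := by
        rw [EuclideanSpace.volume_ball, Fintype.card_fin, ← ENNReal.ofReal_pow hr.le,
          ← ENNReal.ofReal_mul (by positivity), ← ENNReal.ofReal_mul hc, ← ENNReal.ofReal_mul hc]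
        ring_nf
    _ ≤ ENNReal.ofReal c * volume (μ.support ∩ Metric.ball x r) := by
        gcongr
        exact h.regular x hx r hr hr₀
    _ = ∫⁻ _ in μ.support ∩ Metric.ball x r, ENNReal.ofReal c := by
        rw [lintegral_const, Measure.restrict_apply_univ]
    _ ≤ ∫⁻ y in μ.support ∩ Metric.ball x r, p y :=
        setLIntegral_mono hp fun y hy => (hpd y hy.1).1.le
    _ = μ (μ.support ∩ Metric.ball x r) := by
        have e := withDensity_apply p (μ := volume) hS
        rw [← hμ] at e
        exact e.symm
    _ ≤ μ (Metric.ball x r) := measure_mono Set.inter_subset_right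

/-- Each machine uses at most a fraction of order `p` of its observations. -/
theorem localK_ceil_le {m : ℕ} [NeZero m] {n : Fin m → ℕ} (hn : ∀ j, 0 < n j) (hanti : Antitone n)
    {κ p : ℝ} (hκ : 0 ≤ κ) (hκp : κ ≤ p / 4) (hp : ∀ j, 8 ≤ n j * p) (j : Fin m) :
    (localK n ⌈κ * n 0⌉₊ j : ℝ) ≤ n j * p / 2 := by
  have h0 : (0 : ℝ) < n 0 := by exact_mod_cast hn 0
  have hj0 : (n j : ℝ) ≤ n 0 := by exact_mod_cast hanti (Fin.zero_le j)
  -- The two roundings add at most `2` on machine `j`, the inner one because `n j ≤ n 0`; `8 ≤ n j *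
  -- p` absorbs this into `n j * p / 4`.
  have h1 : (localK n ⌈κ * n 0⌉₊ j : ℝ) < (⌈κ * n 0⌉₊ : ℝ) * n j / n 0 + 1 :=
    Nat.ceil_lt_add_one (by positivity)
  have h2 : (⌈κ * n 0⌉₊ : ℝ) < κ * n 0 + 1 := Nat.ceil_lt_add_one (by positivity)
  have h3 : (⌈κ * n 0⌉₊ : ℝ) * n j / n 0 ≤ κ * n j + 1 := by
    rw [div_le_iff₀ h0]
    calc (⌈κ * n 0⌉₊ : ℝ) * n j ≤ (κ * n 0 + 1) * n j := by gcongr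
      _ ≤ (κ * n j + 1) * n 0 := by nlinarith
  have h4 : κ * n j ≤ p / 4 * n j := by gcongr
  linarith [hp j]

/-- There are at most `N` terms of each kind, each at most `N ^ (-2)`; the constant `20` is twice
the Chernoff denominator `10`. -/
theorem sum_exp_neg_le {m : ℕ} [NeZero m] {n : Fin m → ℕ} {N d : ℕ} (hN : 3 ≤ N)
    (hn : ∀ j, 0 < n j) (hsum : totalSize n = N) {p : ℝ}
    (hp : ∀ j, 20 * Real.log N ≤ n j * p) :
    n 0 * Real.exp (-(((d : ℝ) + 2) * Real.log N)) + ∑ j, Real.exp (-(n j * p / 10)) ≤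
      2 / N := by
  have hN0 : (0 : ℝ) < N := by positivity
  have hlog : 0 ≤ Real.log N := Real.log_natCast_nonneg N
  have e : Real.exp (-(2 * Real.log N)) = 1 / (N : ℝ) ^ 2 := by
    rw [Real.exp_neg, two_mul, Real.exp_add, Real.exp_log hN0]
    field_simp
  have h0 : (n 0 : ℝ) ≤ N := by
    have : n 0 ≤ totalSize n := Finset.single_le_sum (fun _ _ => Nat.zero_le _) (Finset.mem_univ 0)
    exact_mod_cast hsum ▸ this
  have hm : (m : ℝ) ≤ N := by
    have : ∑ _j : Fin m, 1 ≤ totalSize n := Finset.sum_le_sum fun j _ => hn j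
    simp only [Finset.sum_const, Finset.card_univ, Fintype.card_fin, smul_eq_mul, mul_one] at this
    exact_mod_cast hsum ▸ this
  have h1 : n 0 * Real.exp (-(((d : ℝ) + 2) * Real.log N)) ≤ N * (1 / (N : ℝ) ^ 2) := by
    rw [← e]
    gcongr
    simp
  have h2 : ∑ j, Real.exp (-(n j * p / 10)) ≤ N * (1 / (N : ℝ) ^ 2) := by
    rw [← e]
    calc ∑ j, Real.exp (-(n j * p / 10)) ≤ ∑ _j : Fin m, Real.exp (-(2 * Real.log N)) :=
          Finset.sum_le_sum fun j _ => Real.exp_le_exp.2 (by linarith [hp j])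
      _ = m * Real.exp (-(2 * Real.log N)) := by simp
      _ ≤ _ := by gcongr
  have h3 : (N : ℝ) * (1 / (N : ℝ) ^ 2) = 1 / N := by field_simp
  rw [h3] at h1 h2
  have : (2 : ℝ) / N = 1 / N + 1 / N := by ring
  linarith

/-! ### Assembly of the rate -/

/-- Regret bound in terms of a radius `r`, under explicit relations between `r` and the
sample sizes. -/
theorem regret_adaptiveClassifier_le {d : ℕ} (hd : 1 ≤ d) {cl rl β Cβ α Cα : ℝ} (hcl : 0 < cl)
    (hβ : 0 < β) (hCβ : 0 < Cβ) (P : Measure (Obs d)) [IsProbabilityMeasure P]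
    {η : Feature d → ℝ} (hη : IsRegressionFunction P η) (hdens : StrongDensity P.fst cl rl)
    (hsm : HolderSmooth P.fst η β Cβ) (hmar : MarginCondition P.fst η α Cα) {m : ℕ} [NeZero m]
    {n : Fin m → ℕ} (hn : ∀ j, 0 < n j) (hanti : Antitone n) (hN : 3 ≤ totalSize n)
    (hlog : 1 ≤ Real.log (totalSize n)) {r t p κ : ℝ} (hr : 0 < r) (hrl : r < rl)
    (ht : t = 2 * Cβ * r ^ β) (ht1 : t ≤ 1 / 2)
    (hp : p = cl ^ 2 * (√Real.pi ^ d / Real.Gamma (d / 2 + 1)) * r ^ d)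
    (hκ : κ = 9 * ((d : ℝ) + 2) * Real.log (totalSize n) / (totalSize n * t ^ 2))
    (hκp : κ ≤ p / 4)
    (hκN : κ < (totalSize n : ℝ) ^ (-((d : ℝ) / (2 + d))) * Real.log (totalSize n))
    (hnp : ∀ j, 20 * Real.log (totalSize n) ≤ n j * p) :
    regret P η (adaptiveClassifier (d := d) (n := n)) ≤
      2 * t * (Cα * t ^ α) + 2 / totalSize n := by
  have htpos : 0 < t := by rw [ht]; positivity
  have hN0 : (0 : ℝ) < totalSize n := by positivity
  have hlpos : 0 < Real.log (totalSize n) := by linarith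
  have hκpos : 0 < κ := by rw [hκ]; positivity
  have hsig : 9 * (((d : ℝ) + 2) * Real.log (totalSize n)) ≤ κ * totalSize n * t ^ 2 := by
    rw [hκ]
    apply le_of_eq
    field_simp
  have hball : ∀ x, MeasurableSet {w : Obs d | dist w.1 x < r} := fun x =>
    measurableSet_lt (measurable_fst.dist measurable_const) measurable_const
  have hsupp : ∀ᵐ x ∂P.fst, x ∈ P.fst.support := Measure.support_mem_ae
  refine (regret_le P hη measurable_adaptiveClassifier htpos.le
    (by positivity : (0 : ℝ) ≤ 2 / totalSize n) ?_).trans ?_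
  · filter_upwards [hη, hsupp] with x hηx hx htx
    refine (measure_adaptiveClassifier_ne_le P x hn (r := r) (p := p) htpos hκpos htx ?_ ?_
      (localK_ceil_le hn hanti hκpos.le hκp fun j => by linarith [hnp j]) hlpos hsig hκN).trans
      (ENNReal.ofReal_le_ofReal (sum_exp_neg_le hN hn rfl hnp))
    · filter_upwards [ae_fst_of_ae hη, ae_fst_of_ae hsupp] with w hηw hw hwr
      -- Hölder continuity gives `Cβ * r ^ β`, which is `t / 2` by the choice of `t`.
      rw [← hηx, ← hηw]
      refine (hsm _ hw _ hx).trans ?_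
      rw [← dist_eq_norm]
      have : dist w.1 x ^ β ≤ r ^ β := Real.rpow_le_rpow dist_nonneg hwr.le hβ.le
      rw [ht]
      nlinarith
    · rw [hp]
      refine (hdens.le_measure_ball hd hcl.le hx hr hrl).trans (le_of_eq ?_)
      rw [Measure.fst_apply measurableSet_ball]
      rfl
  · gcongr
    exact hmar t htpos ht1

end DistNN

theorem theorem1 (d : ℕ) (hd : 1 ≤ d)
    (cl rl : ℝ) (hcl : 0 < cl) (hrl : 0 < rl)
    (β Cβ : ℝ) (hβ : 0 < β) (hβ1 : β ≤ 1) (hCβ : 0 < Cβ)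
    (α Cα : ℝ) (hα : 0 ≤ α) (hαd : α ≤ d / β) (hCα : 0 < Cα)
    (ε c : ℝ) (hε : ε < 2 * β / (2 * β + d)) (hc : 0 < c) :
    ∃ C : ℝ, 0 < C ∧ ∃ N₀ : ℕ,
      ∀ (P : Measure (DistNN.Obs d)) [IsProbabilityMeasure P] (η : DistNN.Feature d → ℝ),
        P.fst (DistNN.unitCube d)ᶜ = 0 →
        DistNN.IsRegressionFunction P η →
        DistNN.StrongDensity P.fst cl rl →
        DistNN.HolderSmooth P.fst η β Cβ →
        DistNN.MarginCondition P.fst η α Cα →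
        ∀ N : ℕ, N₀ ≤ N →
        ∀ (m : ℕ) [NeZero m] (n : Fin m → ℕ),
          Antitone n →
          DistNN.totalSize n = N →
          (∀ j, c * (N : ℝ) ^ (1 - ε) ≤ n j) →
          DistNN.regret P η (DistNN.adaptiveClassifier (d := d) (n := n)) ≤
            C * ((N : ℝ) / Real.log N) ^ (-(β * (1 + α) / (2 * β + d))) := by
  have hs : 0 < 2 * β + d := by positivity
  set b : ℝ := cl ^ 2 * (√Real.pi ^ d / Real.Gamma (d / 2 + 1)) with hb
  have hbpos : 0 < b := by
    have : 0 < Real.Gamma ((d : ℝ) / 2 + 1) := Real.Gamma_pos_of_pos (by positivity)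
    have := Real.pi_pos
    positivity
  obtain ⟨E, hE, hE1, hE2⟩ := DistNN.exists_radius_constant
    (a := 9 * ((d : ℝ) + 2) / (Cβ ^ 2 * b)) hβ hs (9 * ((d : ℝ) + 2) / (4 * Cβ ^ 2))
  obtain ⟨N₀, hN₀⟩ := Filter.eventually_atTop.1 (DistNN.eventually_radius_bounds hβ hβ1 hCβ
    (by positivity : 0 < 9 * ((d : ℝ) + 2)) hbpos hc hε hrl hE hE1 hE2)
  -- The first summand covers the points of small margin, the `2` the error term `2 / N`.
  refine ⟨2 * Cα * (2 * Cβ * E ^ β) ^ (1 + α) + 2, by positivity, N₀, ?_⟩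
  intro P _ η _ hη hdens hsm hmar N hN m _ n hanti hsum hmin
  obtain ⟨hN3, hlog, hall⟩ := hN₀ N hN
  obtain ⟨h1, h2, h3, h4, h5⟩ := hall _ _ rfl rfl
  have hN0 : (0 : ℝ) < N := by positivity
  have hlpos : 0 < Real.log N := by linarith
  set ρ : ℝ := Real.log N / N with hρ
  have hρ0 : 0 < ρ := by positivity
  set r : ℝ := E * ρ ^ (1 / (2 * β + d)) with hr
  have hrpos : 0 < r := by positivity
  have hn : ∀ j, 0 < n j := fun j => by
    have : (0 : ℝ) < n j := lt_of_lt_of_le (by positivity) (hmin j)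
    exact_mod_cast this
  subst hsum
  have hreg := DistNN.regret_adaptiveClassifier_le hd hcl hβ hCβ P hη hdens hsm hmar hn hanti hN3
    hlog hrpos h1 rfl h2 rfl rfl h3 h4 fun j => h5.trans (by gcongr; exact hmin j)
  set N := DistNN.totalSize n
  have hrate : ((N : ℝ) / Real.log N) ^ (-(β * (1 + α) / (2 * β + d))) =
      ρ ^ (β * (1 + α) / (2 * β + d)) := by
    rw [Real.rpow_neg (by positivity), ← Real.inv_rpow (by positivity), inv_div]
  have hα1 : 0 < 1 + α := by linarith
  have ht : 2 * Cβ * r ^ β = 2 * Cβ * E ^ β * ρ ^ (β / (2 * β + d)) := by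
    rw [hr, Real.mul_rpow hE.le (by positivity), ← Real.rpow_mul hρ0.le]
    ring_nf
  have htα : (2 * Cβ * r ^ β) ^ (1 + α) =
      (2 * Cβ * E ^ β) ^ (1 + α) * ρ ^ (β * (1 + α) / (2 * β + d)) := by
    rw [ht, Real.mul_rpow (by positivity) (by positivity), ← Real.rpow_mul hρ0.le]
    ring_nf
  -- From `α * β ≤ d`; hence the rate decays no faster than `log N / N` and dominates `1 / N`.
  have hexp : β * (1 + α) / (2 * β + d) ≤ 1 := by
    rw [div_le_one hs]
    rw [le_div_iff₀ hβ] at hαd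
    linarith
  have hρ1 : ρ ≤ 1 := by
    rw [hρ, div_le_one hN0]
    exact (Real.log_le_sub_one_of_pos hN0).trans (by linarith)
  have hNρ : 1 / (N : ℝ) ≤ ρ ^ (β * (1 + α) / (2 * β + d)) :=
    calc 1 / (N : ℝ) ≤ ρ := by rw [hρ]; gcongr
      _ = ρ ^ (1 : ℝ) := (Real.rpow_one ρ).symm
      _ ≤ _ := Real.rpow_le_rpow_of_exponent_ge hρ0 hρ1 hexp
  have htpos : 0 < 2 * Cβ * r ^ β := by positivity
  rw [hrate]
  calc _ ≤ _ := hreg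
    _ = 2 * Cα * (2 * Cβ * r ^ β) ^ (1 + α) + 2 * (1 / N) := by
        rw [Real.rpow_add htpos, Real.rpow_one]; ring
    _ ≤ _ := by
        rw [htα, add_mul]
        linarith
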